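/- A \emph{convex combination (CC) space} is a metric space $(\mathfrak X,d)$ with an operation that assigns to all $n\ge 1$, $\lambda_1,\dots,\lambda_n>0$ with $\sum_i\lambda_i=1$ and $u_1,\dots,u_n\in\mathfrak X$ an element $[\lambda_i,u_i]_{i=1}^n=[\lambda_1,u_1;\dots;\lambda_n,u_n]\in\mathfrak X$ such that $[1,u]=u$ and (i) $[\lambda_i,u_i]_{i=1}^n=[\lambda_{\sigma(i)},u_{\sigma(i)}]_{i=1}^n$ for every permutation $\sigma$; (ii) $[\lambda_i,u_i]_{i=1}^{n+2}=\big[\lambda_1,u_1;\dots;\lambda_n,u_n;\lambda_{n+1}+\lambda_{n+2},\big[\tfrac{\lambda_{n+j}}{\lambda_{n+1}+\lambda_{n+2}},u_{n+j}\big]_{j=1}^2\big]$; (iii) if $\lambda^{(k)}\to\lambda$ with $\lambda^{(k)},\lambda\in(0,1)$, then $[\lambda^{(k)},u;1-\lambda^{(k)},v]\to[\lambda,u;1-\lambda,v]$; (iv) $d([\lambda,u_1;1-\lambda,u_2],[\lambda,v_1;1-\lambda,v_2])\le\lambda d(u_1,v_1)+(1-\lambda)d(u_2,v_2)$ for $\lambda\in(0,1)$;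 (v) for each $u\in\mathfrak X$ the limit $Ku:=\lim_{n\to\infty}[n^{-1},u]_{i=1}^n$ exists. Let $\mathfrak X$ be a separable and complete CC space and $(\Omega,\mathcal F,P)$ a probability space. A Borel measurable $X:\Omega\to\mathfrak X$ is \emph{integrable}, $X\in L^1_{\mathfrak X}$, if $E\,d(a,X)<\infty$ for some $a\in\mathfrak X$. Let $\mathcal G\subset\mathcal F$ be a sub-$\sigma$-algebra. If $X$ takes finitely many values $x_1,\dots,x_k$, put $E(X|\mathcal G)=[P(X=x_i|\mathcal G),Kx_i]_{i=1}^k$, where terms of weight $0$ are omitted. In general, fix $u_0\in K(\mathfrak X)$ and a sequence $(u_j)_{j\ge1}$ dense in $\mathfrak X$, let $\psi_n(x)=u_m$ with $m$ the smallest index in $\{0,\dots,n\}$ such that $d(u_m,x)=\min_{0\le j\le n}d(u_j,x)$, and for $X\in L^1_{\mathfrak X}$ define (up to a null set) $E(X|\mathcal G)=\lim_{n\to\infty}E(\psi_n(X)|\mathcal G)$ a.s. \textbf{Theorem (ergodic theorem).} Let $\tau:\Omega\to\Omega$ be a measure-preserving transformation, i.e. measurable with $P(\tau^{-1}(A))=P(A)$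 for all $A\in\mathcal F$, and let $\mathcal I_\tau=\{A\in\mathcal F:\tau^{-1}(A)=A\}$. If $X\in L^1_{\mathfrak X}$, then, for every choice of $u_0$ and $(u_j)_{j\ge1}$ as above, the limit defining $E(X|\mathcal I_\tau)$ exists a.s., and $$[n^{-1},X\circ\tau^i]_{i=0}^{n-1}\to E(X|\mathcal I_\tau)\quad\text{a.s. as } n\to\infty.$$ -/

import Mathlib

open MeasureTheory Filter Topology

/-- Admissible weights: positive numbers that sum to `1`. -/
def IsWeight {n : ℕ} (w : Fin n → ℝ) : Prop :=
  (∀ i, 0 < w i) ∧ ∑ i, w i = 1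

/-- A convex combination space: a metric space with an operation
`[w 0, u 0; …; w (n-1), u (n-1)]`, written `comb w u`. The operation is only meaningful for
admissible weights, and no axiom restricts its values at other weights. -/
class ConvexCombinationSpace (E : Type*) [MetricSpace E] where
  /-- The convex combination operation. -/
  comb : {n : ℕ} → (Fin n → ℝ) → (Fin n → E) → E
  comb_one : ∀ u : E, comb (fun _ : Fin 1 => (1 : ℝ)) (fun _ => u) = u
  /-- Commutativity. -/
  comb_perm : ∀ {n : ℕ} (w : Fin n → ℝ) (u : Fin n → E), IsWeight w →
    ∀ σ : Equiv.Perm (Fin n), comb w u = comb (w ∘ σ) (u ∘ σ)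
  /-- Associativity: the last two points are combined first. -/
  comb_assoc : ∀ {n : ℕ} (w : Fin n → ℝ) (u : Fin n → E) (a b : ℝ) (x y : E),
    IsWeight (Fin.snoc (Fin.snoc w a : Fin (n + 1) → ℝ) b : Fin (n + 2) → ℝ) →
    comb (Fin.snoc (Fin.snoc w a : Fin (n + 1) → ℝ) b : Fin (n + 2) → ℝ)
        (Fin.snoc (Fin.snoc u x : Fin (n + 1) → E) y : Fin (n + 2) → E) =
      comb (Fin.snoc w (a + b) : Fin (n + 1) → ℝ)
        (Fin.snoc u (comb ![a / (a + b), b / (a + b)] ![x, y]) : Fin (n + 1) → E)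
  /-- Continuity in the weight. -/
  comb_continuous : ∀ (u v : E) (l : ℕ → ℝ) (l₀ : ℝ),
    (∀ k, l k ∈ Set.Ioo (0 : ℝ) 1) → l₀ ∈ Set.Ioo (0 : ℝ) 1 → Tendsto l atTop (𝓝 l₀) →
    Tendsto (fun k => comb ![l k, 1 - l k] ![u, v]) atTop (𝓝 (comb ![l₀, 1 - l₀] ![u, v]))
  /-- Negative curvature. -/
  dist_comb_le : ∀ (u₁ u₂ v₁ v₂ : E) (l : ℝ), l ∈ Set.Ioo (0 : ℝ) 1 →
    dist (comb ![l, 1 - l] ![u₁, u₂]) (comb ![l, 1 - l] ![v₁, v₂]) ≤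
      l * dist u₁ v₁ + (1 - l) * dist u₂ v₂
  /-- Convexification. -/
  exists_convexification : ∀ u : E, ∃ k : E,
    Tendsto (fun n : ℕ => comb (fun _ : Fin n => (n : ℝ)⁻¹) (fun _ => u)) atTop (𝓝 k)

namespace ConvexCombinationSpace

noncomputable section

variable {E : Type*} [MetricSpace E] [ConvexCombinationSpace E]

/-- The average `[n⁻¹, u i]` over `i = 0, …, n - 1`. -/
def average (n : ℕ) (u : ℕ → E) : E :=
  comb (fun _ : Fin n => (n : ℝ)⁻¹) (fun i => u i)

/-- The convexification operator: `K u` is the limit of `[n⁻¹, u]` taken `n` times. -/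
def K (u : E) : E := (exists_convexification u).choose

/-- The combination of the points `u i`, `i ∈ s`, where points of zero weight are dropped.
The enumeration of the remaining points is arbitrary (the operation is commutative). -/
def combOn {ι : Type*} (s : Finset ι) (w : ι → ℝ) (u : ι → E) : E :=
  comb (fun i => w ((s.filter fun j => 0 < w j).equivFin.symm i))
    (fun i => u ((s.filter fun j => 0 < w j).equivFin.symm i))

variable {Ω : Type*}

/-- Conditional expectation of a simple random element `S` with values `x`:
the combination of the points `K x` with the weights `P(S = x | m)`. -/
def condExpSimple [MeasurableSpace E] (m : MeasurableSpace Ω) {m₀ : MeasurableSpace Ω}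
    (μ : Measure Ω) (S : SimpleFunc Ω E) (ω : Ω) : E :=
  combOn S.range
    (fun x => (μ[(S ⁻¹' {x}).indicator (fun _ => (1 : ℝ)) | m]) ω) (fun x => K x)

/-- `E(ψ_n(X) | m)`, where `ψ_n(x)` is the point among `u 0, …, u n` nearest to `x`,
that of smallest index if there are several. -/
def condExpApprox [MeasurableSpace E] [OpensMeasurableSpace E] (u : ℕ → E)
    (m : MeasurableSpace Ω) {m₀ : MeasurableSpace Ω} (μ : Measure Ω)
    (X : Ω → E) (hX : Measurable X) (n : ℕ) (ω : Ω) : E :=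
  condExpSimple m μ ((SimpleFunc.nearestPt u n).comp X hX) ω

/-- The conditional expectation `E(X | m)`: the pointwise limit of `E(ψ_n(X) | m)`
(an arbitrary value where the limit does not exist). -/
def condExp [MeasurableSpace E] [OpensMeasurableSpace E] (u : ℕ → E)
    (m : MeasurableSpace Ω) {m₀ : MeasurableSpace Ω} (μ : Measure Ω)
    (X : Ω → E) (hX : Measurable X) (ω : Ω) : E :=
  haveI : Nonempty E := ⟨u 0⟩
  limUnder atTop (fun n => condExpApprox u m μ X hX n ω)

end

end ConvexCombinationSpace

/-! The proof reduces to simple random elements and the real Birkhoff theorem.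

For simple `S`, group the average along an orbit by value. It becomes a combination of points
[1/c,x] (c copies of x) weighted by the visit frequencies c/n. By Birkhoff's theorem the frequencies
tend to the conditional probabilities. Values of conditional probability 0 are a.s. never visited;
for the others c → ∞, so the inner averages tend to `K x`. Joint continuity of `comb`
(`tendsto_comb`) gives the limit. The regrouping is a rearrangement of sums in a commutative monoid
of weighted points (`sum_weighted_eq`).

For general X, negative curvature bounds the distance between the averages of X and of ψ_k(X) by the
Birkhoff averages of d(X, ψ_k(X)). These tend to a conditional expectation that vanishes a.s. as k →
∞. By completeness (`exists_tendsto_of_dist_le`) the averages of X and the elements E(ψ_k(X) |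
invariants) converge to one common limit. -/

namespace ConvexCombinationSpace

/-! ### Convex combinations as sums in a commutative monoid. -/

/-- Points of `E` carrying a positive mass. -/
structure WeightedPoint (E : Type*) where
  /-- The mass. -/
  mass : ℝ
  /-- The location. -/
  point : E
  mass_pos : 0 < mass

attribute [ext] WeightedPoint

noncomputable section

section

variable {E : Type*}

open Classical in
/-- The point `x` with mass `w` as an element of the additive monoid obtained by adjoining a
zero to the weighted points; it is zero if the mass is not positive. -/
def weighted (w : ℝ) (x : E) : WithZero (WeightedPoint E) :=
  if h : 0 < w then ((⟨w, x, h⟩ : WeightedPoint E) : WithZero (WeightedPoint E)) else 0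

theorem weighted_of_nonpos {w : ℝ} (h : w ≤ 0) (x : E) : weighted w x = 0 := by
  simp [weighted, h.not_gt]

/-- Lets identities between points of `E` be verified in the monoid, at unit mass. -/
theorem weighted_one_injective : Function.Injective (weighted (E := E) 1) := by
  intro x y h
  simpa [weighted] using h

end

variable {E : Type*} [MetricSpace E] [ConvexCombinationSpace E]

theorem isWeight_pair {a b : ℝ} (ha : 0 < a) (hb : 0 < b) :
    IsWeight ![a / (a + b), b / (a + b)] := by
  refine ⟨fun i => by fin_cases i <;> simp <;> positivity, ?_⟩
  simp only [Fin.sum_univ_two, Matrix.cons_val_zero, Matrix.cons_val_one]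
  field_simp

theorem comb_pair_comm {a b : ℝ} (ha : 0 < a) (hb : 0 < b) (x y : E) :
    comb ![a / (a + b), b / (a + b)] ![x, y] = comb ![b / (b + a), a / (b + a)] ![y, x] := by
  rw [comb_perm _ _ (isWeight_pair ha hb) (Equiv.swap 0 1), add_comm b a]
  congr 1 <;> (ext i; fin_cases i <;> simp)

theorem comb_triple {a b c : ℝ} (ha : 0 < a) (hb : 0 < b) (hc : 0 < c) (h : a + b + c = 1)
    (x y z : E) :
    comb ![a, b, c] ![x, y, z] =
      comb ![a, b + c] ![x, comb ![b / (b + c), c / (b + c)] ![y, z]] := by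
  have e1 : (Fin.snoc (Fin.snoc ![a] b : Fin 2 → ℝ) c : Fin 3 → ℝ) = ![a, b, c] := by
    ext i; fin_cases i <;> rfl
  have e2 : (Fin.snoc (Fin.snoc ![x] y : Fin 2 → E) z : Fin 3 → E) = ![x, y, z] := by
    ext i; fin_cases i <;> rfl
  have e3 : (Fin.snoc ![a] (b + c) : Fin 2 → ℝ) = ![a, b + c] := by
    ext i; fin_cases i <;> rfl
  have e4 (t : E) : (Fin.snoc ![x] t : Fin 2 → E) = ![x, t] := by
    ext i; fin_cases i <;> rfl
  have hw : IsWeight ![a, b, c] := by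
    refine ⟨fun i => by fin_cases i <;> simpa, ?_⟩
    simpa [Fin.sum_univ_three] using h
  have := comb_assoc ![a] ![x] b c y z (by rw [e1]; exact hw)
  rwa [e1, e2, e3, e4] at this

theorem comb_triple_rotate {a b c : ℝ} (ha : 0 < a) (hb : 0 < b) (hc : 0 < c) (h : a + b + c = 1)
    (x y z : E) : comb ![a, b, c] ![x, y, z] = comb ![c, a, b] ![z, x, y] := by
  have hw : IsWeight ![a, b, c] := by
    refine ⟨fun i => by fin_cases i <;> simpa, ?_⟩
    simpa [Fin.sum_univ_three] using h
  rw [comb_perm _ _ hw (finRotate 3).symm]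
  congr 1 <;> (ext i; fin_cases i <;> rfl)

namespace WeightedPoint

instance : Add (WeightedPoint E) where
  add p q := ⟨p.mass + q.mass,
    comb ![p.mass / (p.mass + q.mass), q.mass / (p.mass + q.mass)] ![p.point, q.point],
    add_pos p.mass_pos q.mass_pos⟩

theorem mass_add (p q : WeightedPoint E) : (p + q).mass = p.mass + q.mass := rfl

theorem point_add (p q : WeightedPoint E) : (p + q).point =
    comb ![p.mass / (p.mass + q.mass), q.mass / (p.mass + q.mass)] ![p.point, q.point] := rfl

instance : AddCommSemigroup (WeightedPoint E) where
  add_comm p q := WeightedPoint.ext (add_comm _ _) (comb_pair_comm p.mass_pos q.mass_pos _ _)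
  add_assoc p q r := by
    refine WeightedPoint.ext (add_assoc _ _ _) ?_
    obtain ⟨a, x, ha⟩ := p
    obtain ⟨b, y, hb⟩ := q
    obtain ⟨c, z, hc⟩ := r
    simp only [point_add, mass_add]
    have hs : 0 < a + b + c := by positivity
    have hab : 0 < a + b := by positivity
    have hbc : 0 < b + c := by positivity
    have h1 : a / (a + b + c) + b / (a + b + c) + c / (a + b + c) = 1 := by field_simp
    have h2 : c / (a + b + c) + a / (a + b + c) + b / (a + b + c) = 1 := by field_simp; ring
    have e1 := comb_triple (div_pos ha hs) (div_pos hb hs) (div_pos hc hs) h1 x y z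
    have e2 := comb_triple (div_pos hc hs) (div_pos ha hs) (div_pos hb hs) h2 z x y
    have e3 := comb_triple_rotate (div_pos ha hs) (div_pos hb hs) (div_pos hc hs) h1 x y z
    rw [← add_div, div_div_div_cancel_right₀ hs.ne', div_div_div_cancel_right₀ hs.ne'] at e1 e2
    -- `comb_assoc` merges only the last two points, so the left bracketing is first turned into `z`
    -- against the merged `x`, `y`. Both sides are then three-point combinations differing by a
    -- rotation.
    rw [comb_pair_comm hab hc, add_comm c (a + b), ← e2, ← e3, e1, add_assoc a b c]

end WeightedPoint

theorem weighted_add_weighted {a b : ℝ} (ha : 0 < a) (hb : 0 < b) (x y : E) :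
    weighted a x + weighted b y =
      weighted (a + b) (comb ![a / (a + b), b / (a + b)] ![x, y]) := by
  simp only [weighted, ha, hb, add_pos ha hb, dite_true, ← WithZero.coe_add]
  rfl

/-- A convex combination is the location of the sum of its weighted points. -/
theorem sum_weighted_eq {n : ℕ} (w : Fin n → ℝ) (u : Fin n → E) (hw : IsWeight w) :
    ∑ i, weighted (w i) (u i) = weighted 1 (comb w u) := by
  induction n with
  | zero => simpa using hw.2
  | succ n ih =>
    cases n with
    | zero =>
      have h1 : w = fun _ => 1 := by
        ext i; fin_cases i; simpa using hw.2
      have h2 : u = fun _ => u 0 := by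
        ext i; fin_cases i; rfl
      rw [h1, h2, comb_one]; simp
    | succ n =>
      obtain ⟨w', b, rfl⟩ : ∃ w' b, w = Fin.snoc (α := fun _ => ℝ) w' b :=
        ⟨_, _, (Fin.snoc_init_self w).symm⟩
      obtain ⟨w, a, rfl⟩ : ∃ w b, w' = Fin.snoc (α := fun _ => ℝ) w b :=
        ⟨_, _, (Fin.snoc_init_self w').symm⟩
      obtain ⟨u', y, rfl⟩ : ∃ w' b, u = Fin.snoc (α := fun _ => E) w' b :=
        ⟨_, _, (Fin.snoc_init_self u).symm⟩
      obtain ⟨u, x, rfl⟩ : ∃ w b, u' = Fin.snoc (α := fun _ => E) w b :=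
        ⟨_, _, (Fin.snoc_init_self u').symm⟩
      have hb : 0 < b := by simpa using hw.1 (Fin.last _)
      have ha : 0 < a := by simpa using hw.1 (Fin.last _).castSucc
      rw [comb_assoc _ _ _ _ _ _ hw, ← ih]
      · simp only [Fin.sum_univ_castSucc, Fin.snoc_castSucc, Fin.snoc_last, add_assoc,
          weighted_add_weighted ha hb]
      · refine ⟨fun i => ?_, ?_⟩
        · refine Fin.lastCases ?_ (fun i => ?_) i
          · simpa using add_pos ha hb
          · simpa using hw.1 i.castSucc.castSucc
        · simpa [Fin.sum_univ_castSucc, add_assoc] using hw.2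

/-- Multiplication of all masses by `t`. -/
def rescale (t : ℝ) (ht : 0 < t) : WithZero (WeightedPoint E) →+ WithZero (WeightedPoint E) where
  toFun p := WithZero.recZeroCoe 0 (fun p => weighted (p.mass * t) p.point) p
  map_zero' := rfl
  map_add' p q := by
    cases p with
    | zero => simp
    | coe p =>
      cases q with
      | zero => simp
      | coe q =>
        simp only [← WithZero.coe_add, WithZero.recZeroCoe_coe]
        rw [weighted_add_weighted (mul_pos p.mass_pos ht) (mul_pos q.mass_pos ht), ← add_mul,
          mul_div_mul_right _ _ ht.ne', mul_div_mul_right _ _ ht.ne']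
        rfl

theorem rescale_weighted {t : ℝ} (ht : 0 < t) (w : ℝ) (x : E) :
    rescale t ht (weighted w x) = weighted (w * t) x := by
  by_cases h : 0 < w
  · simp [rescale, weighted, h]
  · rw [weighted_of_nonpos (not_lt.1 h), map_zero, weighted_of_nonpos]
    exact mul_nonpos_of_nonpos_of_nonneg (not_lt.1 h) ht.le

theorem isWeight_const {n : ℕ} (hn : n ≠ 0) : IsWeight (fun _ : Fin n => (n : ℝ)⁻¹) :=
  ⟨fun _ => by positivity, by simp [hn]⟩

theorem sum_weighted_average {n : ℕ} (hn : n ≠ 0) (s : ℕ → E) :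
    ∑ i ∈ Finset.range n, weighted (n : ℝ)⁻¹ (s i) = weighted 1 (average n s) := by
  rw [average, ← sum_weighted_eq _ _ (isWeight_const hn), Finset.sum_range]

theorem nsmul_weighted {m : ℕ} {t : ℝ} (ht : 0 < t) (x : E) :
    m • weighted t x = weighted (m * t) (average m fun _ => x) := by
  rcases eq_or_ne m 0 with rfl | hm
  -- The value of `average 0` is arbitrary, but at mass 0 it is not seen.
  · rw [zero_smul, weighted_of_nonpos (by simp)]
  · have hmt : 0 < m * t := by positivity
    -- At unit mass the average is a sum of masses `1 / m`; scaling by `m * t` turns each into `t`.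
    rw [← one_mul (m * t), ← rescale_weighted hmt, ← sum_weighted_average hm, map_sum]
    simp only [rescale_weighted]
    have : (m : ℝ)⁻¹ * (m * t) = t := by field_simp
    simp [this]

/-! ### Contraction and joint continuity of combinations. -/

theorem dist_comb_le_sum {n : ℕ} (w : Fin n → ℝ) (u v : Fin n → E) (hw : IsWeight w) :
    dist (comb w u) (comb w v) ≤ ∑ i, w i * dist (u i) (v i) := by
  induction n with
  | zero => exact absurd hw.2 (by simp)
  | succ n ih =>
    cases n with
    | zero =>
      have h1 : w = fun _ => 1 := by
        ext i; fin_cases i; simpa using hw.2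
      have h2 (u : Fin 1 → E) : u = fun _ => u 0 := by
        ext i; fin_cases i; rfl
      rw [h1, h2 u, h2 v, comb_one, comb_one]; simp
    | succ n =>
      obtain ⟨w', b, rfl⟩ : ∃ w' b, w = Fin.snoc (α := fun _ => ℝ) w' b :=
        ⟨_, _, (Fin.snoc_init_self w).symm⟩
      obtain ⟨w, a, rfl⟩ : ∃ w b, w' = Fin.snoc (α := fun _ => ℝ) w b :=
        ⟨_, _, (Fin.snoc_init_self w').symm⟩
      obtain ⟨u', y, rfl⟩ : ∃ w' b, u = Fin.snoc (α := fun _ => E) w' b :=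
        ⟨_, _, (Fin.snoc_init_self u).symm⟩
      obtain ⟨u, x, rfl⟩ : ∃ w b, u' = Fin.snoc (α := fun _ => E) w b :=
        ⟨_, _, (Fin.snoc_init_self u').symm⟩
      obtain ⟨v', y', rfl⟩ : ∃ w' b, v = Fin.snoc (α := fun _ => E) w' b :=
        ⟨_, _, (Fin.snoc_init_self v).symm⟩
      obtain ⟨v, x', rfl⟩ : ∃ w b, v' = Fin.snoc (α := fun _ => E) w b :=
        ⟨_, _, (Fin.snoc_init_self v').symm⟩
      have hb : 0 < b := by simpa using hw.1 (Fin.last _)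
      have ha : 0 < a := by simpa using hw.1 (Fin.last _).castSucc
      have hab := add_pos ha hb
      have hone : b / (a + b) = 1 - a / (a + b) := by field_simp; ring
      rw [comb_assoc _ _ _ _ _ _ hw, comb_assoc _ _ _ _ _ _ hw]
      refine (ih _ _ _ ?_).trans ?_
      · refine ⟨fun i => ?_, ?_⟩
        · refine Fin.lastCases ?_ (fun i => ?_) i
          · simpa using add_pos ha hb
          · simpa using hw.1 i.castSucc.castSucc
        · simpa [Fin.sum_univ_castSucc, add_assoc] using hw.2
      · simp only [Fin.sum_univ_castSucc, Fin.snoc_castSucc, Fin.snoc_last, add_assoc]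
        gcongr
        have := dist_comb_le x y x' y' (a / (a + b))
          ⟨by positivity, by rw [div_lt_one hab]; linarith⟩
        rw [← hone] at this
        calc _ ≤ (a + b) * (a / (a + b) * dist x x' + b / (a + b) * dist y y') := by gcongr
          _ = _ := by field_simp

theorem dist_average_le {n : ℕ} (hn : n ≠ 0) (s t : ℕ → E) :
    dist (average n s) (average n t) ≤ (n : ℝ)⁻¹ * ∑ i ∈ Finset.range n, dist (s i) (t i) := by
  refine (dist_comb_le_sum _ _ _ (isWeight_const hn)).trans_eq ?_
  rw [← Finset.mul_sum, Finset.sum_range]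

/-- The axiom moves the weight with the points held fixed; negative curvature then absorbs the
motion of the points. Countable generation is needed because the axiom speaks of sequences. -/
theorem tendsto_comb_pair {ι : Type*} {x y : ι → E} {x₀ y₀ : E} {l : ι → ℝ} {l₀ : ℝ}
    {F : Filter ι} [F.IsCountablyGenerated]
    (hl : ∀ k, l k ∈ Set.Ioo (0 : ℝ) 1) (hl₀ : l₀ ∈ Set.Ioo (0 : ℝ) 1)
    (h : Tendsto l F (𝓝 l₀)) (hx : Tendsto x F (𝓝 x₀)) (hy : Tendsto y F (𝓝 y₀)) :
    Tendsto (fun k => comb ![l k, 1 - l k] ![x k, y k]) F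
      (𝓝 (comb ![l₀, 1 - l₀] ![x₀, y₀])) := by
  have h1 : Tendsto (fun k => comb ![l k, 1 - l k] ![x₀, y₀]) F
      (𝓝 (comb ![l₀, 1 - l₀] ![x₀, y₀])) :=
    tendsto_of_seq_tendsto fun s hs =>
      comb_continuous x₀ y₀ (l ∘ s) l₀ (fun k => hl _) hl₀ (h.comp hs)
  refine h1.congr_dist (squeeze_zero (fun _ => dist_nonneg)
    (fun k => dist_comb_le x₀ y₀ (x k) (y k) (l k) (hl k)) ?_)
  have e1 := (tendsto_const_nhds (x := x₀)).dist hx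
  have e2 := (tendsto_const_nhds (x := y₀)).dist hy
  simpa using (h.mul e1).add ((h.const_sub 1).mul e2)

theorem tendsto_comb {n : ℕ} {w : ℕ → Fin n → ℝ} {u : ℕ → Fin n → E} {w₀ : Fin n → ℝ}
    {u₀ : Fin n → E} (hw : ∀ k, IsWeight (w k)) (hw₀ : IsWeight w₀)
    (h : ∀ i, Tendsto (fun k => w k i) atTop (𝓝 (w₀ i)))
    (hu : ∀ i, Tendsto (fun k => u k i) atTop (𝓝 (u₀ i))) :
    Tendsto (fun k => comb (w k) (u k)) atTop (𝓝 (comb w₀ u₀)) := by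
  induction n with
  | zero => exact absurd hw₀.2 (by simp)
  | succ n ih =>
    cases n with
    | zero =>
      have h1 (w : Fin 1 → ℝ) (hw : IsWeight w) : w = fun _ => 1 := by
        ext i; fin_cases i; simpa using hw.2
      have h2 (u : Fin 1 → E) : u = fun _ => u 0 := by
        ext i; fin_cases i; rfl
      have h3 (w : Fin 1 → ℝ) (hw : IsWeight w) (u : Fin 1 → E) : comb w u = u 0 := by
        rw [h1 w hw, h2 u, comb_one]
      simp only [h3 _ (hw _), h3 _ hw₀]
      exact hu 0
    | succ n =>
      -- Merging the last two points reduces to `n + 1` points, the last of which converges by the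
      -- two-point case.
      have split (w : Fin (n + 2) → ℝ) (u : Fin (n + 2) → E) (hw : IsWeight w) :
          ∃ l : ℝ, l = w (Fin.last n).castSucc / (w (Fin.last n).castSucc + w (Fin.last _)) ∧
          l ∈ Set.Ioo (0 : ℝ) 1 ∧
          IsWeight (Fin.snoc (fun i : Fin n => w i.castSucc.castSucc)
              (w (Fin.last n).castSucc + w (Fin.last _)) : Fin (n + 1) → ℝ) ∧
          comb w u = comb (Fin.snoc (fun i : Fin n => w i.castSucc.castSucc)
              (w (Fin.last n).castSucc + w (Fin.last _)) : Fin (n + 1) → ℝ)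
            (Fin.snoc (fun i : Fin n => u i.castSucc.castSucc)
              (comb ![l, 1 - l] ![u (Fin.last n).castSucc, u (Fin.last _)]) :
                Fin (n + 1) → E) := by
        have ha := hw.1 (Fin.last n).castSucc
        have hb := hw.1 (Fin.last _)
        have hab := add_pos ha hb
        refine ⟨_, rfl, ⟨by positivity, by rw [div_lt_one hab]; linarith⟩, ⟨fun i => ?_, ?_⟩, ?_⟩
        · refine Fin.lastCases ?_ (fun i => ?_) i
          · simpa using hab
          · simpa using hw.1 i.castSucc.castSucc
        · simpa [Fin.sum_univ_castSucc, add_assoc] using hw.2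
        · have hone : w (Fin.last _) / (w (Fin.last n).castSucc + w (Fin.last _)) =
              1 - w (Fin.last n).castSucc / (w (Fin.last n).castSucc + w (Fin.last _)) := by
            field_simp; ring
          rw [← hone, ← comb_assoc]
          · congr 1
            · exact ((Fin.snoc_init_self w).symm.trans
                (congrArg (fun t => Fin.snoc (α := fun _ => ℝ) t _)
                  (Fin.snoc_init_self (Fin.init w)).symm))
            · exact ((Fin.snoc_init_self u).symm.trans
                (congrArg (fun t => Fin.snoc (α := fun _ => E) t _)
                  (Fin.snoc_init_self (Fin.init u)).symm))
          · convert hw using 1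
            exact ((Fin.snoc_init_self w).symm.trans
                (congrArg (fun t => Fin.snoc (α := fun _ => ℝ) t _)
                  (Fin.snoc_init_self (Fin.init w)).symm)).symm
      choose l hl hlI hlw hlc using fun k => split (w k) (u k) (hw k)
      obtain ⟨l₀, hl₀, hlI₀, hlw₀, hlc₀⟩ := split w₀ u₀ hw₀
      simp only [hlc, hlc₀]
      have hsum := (h (Fin.last n).castSucc).add (h (Fin.last _))
      have hlt : Tendsto l atTop (𝓝 l₀) := by
        simp only [funext hl, hl₀]
        exact (h _).div hsum (add_pos (hw₀.1 _) (hw₀.1 _)).ne'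
      refine ih hlw hlw₀ (fun i => ?_) (fun i => ?_)
      · refine Fin.lastCases ?_ (fun i => ?_) i
        · simpa using hsum
        · simpa using h i.castSucc.castSucc
      · refine Fin.lastCases ?_ (fun i => ?_) i
        · simpa using tendsto_comb_pair hlI hlI₀ hlt (hu _) (hu _)
        · simpa using hu i.castSucc.castSucc

theorem tendsto_average_const (x : E) :
    Tendsto (fun n => average n fun _ => x) atTop (𝓝 (K x)) :=
  (exists_convexification x).choose_spec

end

end ConvexCombinationSpace

/-! ### The pointwise ergodic theorem for real functions -/

section Birkhoff

variable {Ω : Type*}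

/-- The largest of the first `n + 1` nonempty Birkhoff sums of `f`, defined recursively. -/
def birkhoffMax (τ : Ω → Ω) (f : Ω → ℝ) : ℕ → Ω → ℝ
  | 0 => f
  | n + 1 => fun ω => f ω + max 0 (birkhoffMax τ f n (τ ω))

theorem birkhoffMax_succ (τ : Ω → Ω) (f : Ω → ℝ) (n : ℕ) (ω : Ω) :
    birkhoffMax τ f (n + 1) ω = f ω + max 0 (birkhoffMax τ f n (τ ω)) := rfl

theorem birkhoffMax_le_succ (τ : Ω → Ω) (f : Ω → ℝ) (n : ℕ) (ω : Ω) :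
    birkhoffMax τ f n ω ≤ birkhoffMax τ f (n + 1) ω := by
  induction n generalizing ω with
  | zero => simp [birkhoffMax]
  | succ n ih =>
    rw [birkhoffMax_succ, birkhoffMax_succ τ f (n + 1)]
    gcongr
    exact ih _

theorem birkhoffMax_monotone (τ : Ω → Ω) (f : Ω → ℝ) (ω : Ω) :
    Monotone fun n => birkhoffMax τ f n ω :=
  monotone_nat_of_le_succ fun n => birkhoffMax_le_succ τ f n ω

theorem birkhoffSum_succ_le_birkhoffMax (τ : Ω → Ω) (f : Ω → ℝ) (n : ℕ) (ω : Ω) :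
    birkhoffSum τ f (n + 1) ω ≤ birkhoffMax τ f n ω := by
  induction n generalizing ω with
  | zero => simp [birkhoffMax]
  | succ n ih =>
    rw [birkhoffSum_succ', birkhoffMax_succ]
    gcongr
    exact (ih _).trans (le_max_right _ _)

/-- Makes the set where the maxima are unbounded strictly invariant, hence a member of
`MeasurableSpace.invariants τ`. -/
theorem bddAbove_birkhoffMax_comp_iff (τ : Ω → Ω) (f : Ω → ℝ) (ω : Ω) :
    BddAbove (Set.range fun n => birkhoffMax τ f n (τ ω)) ↔
      BddAbove (Set.range fun n => birkhoffMax τ f n ω) := by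
  constructor
  · rintro ⟨C, hC⟩
    refine ⟨f ω + max 0 C, ?_⟩
    rintro _ ⟨n, rfl⟩
    refine (birkhoffMax_le_succ τ f n ω).trans ?_
    rw [birkhoffMax_succ]
    gcongr
    exact hC ⟨n, rfl⟩
  · rintro ⟨C, hC⟩
    refine ⟨C - f ω, ?_⟩
    rintro _ ⟨n, rfl⟩
    have := hC ⟨n + 1, rfl⟩
    simp only [birkhoffMax_succ] at this
    have := le_max_right 0 (birkhoffMax τ f n (τ ω))
    simp only
    linarith

variable [MeasurableSpace Ω] {μ : Measure Ω} {τ : Ω → Ω} {f : Ω → ℝ}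

theorem measurable_birkhoffMax (hτ : Measurable τ) (hf : Measurable f) (n : ℕ) :
    Measurable (birkhoffMax τ f n) := by
  induction n with
  | zero => exact hf
  | succ n ih => exact hf.add (measurable_const.max (ih.comp hτ))

theorem integrable_birkhoffMax (hτ : MeasurePreserving τ μ μ) (hf : Integrable f μ) (n : ℕ) :
    Integrable (birkhoffMax τ f n) μ := by
  induction n with
  | zero => exact hf
  | succ n ih =>
    refine hf.add ?_
    have := (hτ.integrable_comp_of_integrable ih).pos_part
    simpa only [max_comm, Function.comp_def] using this

/-- A form of the maximal ergodic theorem. -/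
theorem integral_nonneg_of_birkhoffMax_unbounded (hτ : MeasurePreserving τ μ μ)
    (hfi : Integrable f μ)
    (h : ∀ᵐ ω ∂μ, ¬ BddAbove (Set.range fun n => birkhoffMax τ f n ω)) :
    0 ≤ ∫ ω, f ω ∂μ := by
  have hcomp (n : ℕ) : Integrable (fun ω => birkhoffMax τ f n (τ ω)) μ :=
    hτ.integrable_comp_of_integrable (integrable_birkhoffMax hτ hfi n)
  -- The integrand is `f` plus the negative part of the `n`-th maximum at `τ ω`. That part is at
  -- most `|f (τ ω)|`, since the maxima start at `f`, and vanishes eventually where they are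
  -- unbounded.
  have hlim : Tendsto (fun n => ∫ ω, (birkhoffMax τ f (n + 1) ω - birkhoffMax τ f n (τ ω)) ∂μ)
      atTop (𝓝 (∫ ω, f ω ∂μ)) := by
    refine tendsto_integral_of_dominated_convergence (fun ω => |f ω| + |f (τ ω)|)
      (fun n => ((integrable_birkhoffMax hτ hfi _).sub (hcomp n)).aestronglyMeasurable)
      (hfi.abs.add (hτ.integrable_comp_of_integrable hfi).abs) (fun n => ae_of_all _ fun ω => ?_) ?_
    · have h0 : f (τ ω) ≤ birkhoffMax τ f n (τ ω) := birkhoffMax_monotone τ f (τ ω) n.zero_le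
      rw [Real.norm_eq_abs, birkhoffMax_succ, add_sub_assoc]
      refine (abs_add_le _ _).trans (add_le_add le_rfl ?_)
      rcases le_total 0 (birkhoffMax τ f n (τ ω)) with h1 | h1
      · simp [max_eq_right h1]
      · rw [max_eq_left h1, zero_sub, abs_neg, abs_of_nonpos h1, abs_of_nonpos (h0.trans h1)]
        linarith
    · filter_upwards [h] with ω hω
      rw [← bddAbove_birkhoffMax_comp_iff] at hω
      have ht := tendsto_atTop_atTop_of_monotone (birkhoffMax_monotone τ f (τ ω)) fun b => by
        by_contra! hb
        exact hω ⟨b, by rintro _ ⟨n, rfl⟩; exact (hb n).le⟩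
      refine tendsto_const_nhds.congr' ?_
      filter_upwards [ht.eventually_ge_atTop 0] with n hn
      rw [birkhoffMax_succ, max_eq_right hn]
      ring
  -- By invariance of `μ` the integral is that of the increment of the maxima from `n` to `n + 1`,
  -- which is nonnegative.
  refine ge_of_tendsto' hlim fun n => ?_
  rw [integral_sub (integrable_birkhoffMax hτ hfi _) (hcomp n)]
  have e : ∫ ω, birkhoffMax τ f n (τ ω) ∂μ = ∫ ω, birkhoffMax τ f n ω ∂μ := by
    have hm := (integrable_birkhoffMax hτ hfi n).aestronglyMeasurable
    rw [← hτ.map_eq] at hm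
    conv_rhs => rw [← hτ.map_eq]
    exact (integral_map hτ.measurable.aemeasurable hm).symm
  rw [e, sub_nonneg]
  exact integral_mono (integrable_birkhoffMax hτ hfi _) (integrable_birkhoffMax hτ hfi _)
    (birkhoffMax_le_succ τ f n)

/-- On the invariant set of unboundedness the maximal inequality gives `f` a nonnegative integral.
Its conditional expectation has the same integral there but is negative, so the set is null. -/
theorem ae_bddAbove_birkhoffMax [IsFiniteMeasure μ] (hτ : MeasurePreserving τ μ μ)
    (hf : Measurable f) (hfi : Integrable f μ)
    (hneg : ∀ᵐ ω ∂μ, (μ[f | MeasurableSpace.invariants τ]) ω < 0) :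
    ∀ᵐ ω ∂μ, BddAbove (Set.range fun n => birkhoffMax τ f n ω) := by
  set A : Set Ω := {ω | ¬ BddAbove (Set.range fun n => birkhoffMax τ f n ω)} with hA
  have hAm : MeasurableSet A :=
    (measurableSet_bddAbove_range fun n => measurable_birkhoffMax hτ.measurable hf n).compl
  have hAτ : τ ⁻¹' A = A := by
    ext ω
    simp only [hA, Set.mem_preimage, Set.mem_ofPred_eq, bddAbove_birkhoffMax_comp_iff]
  have hres : MeasurePreserving τ (μ.restrict A) (μ.restrict A) := by
    have := hτ.restrict_preimage hAm
    rwa [hAτ] at this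
  have h0 : 0 ≤ ∫ ω in A, f ω ∂μ :=
    integral_nonneg_of_birkhoffMax_unbounded hres hfi.restrict (ae_restrict_mem hAm)
  rw [← setIntegral_condExp (MeasurableSpace.invariants_le τ) hfi
    (MeasurableSpace.measurableSet_invariants.2 ⟨hAm, hAτ⟩)] at h0
  have hμA : μ A = 0 := by
    by_contra hne
    have hpos : 0 < ∫ ω in A, -(μ[f | MeasurableSpace.invariants τ]) ω ∂μ := by
      rw [integral_pos_iff_support_of_nonneg_ae]
      · have : (μ.restrict A) (Function.support
            fun ω => -(μ[f | MeasurableSpace.invariants τ]) ω) = (μ.restrict A) Set.univ := by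
          refine measure_congr (eventuallyEq_univ.2 ?_)
          filter_upwards [ae_restrict_of_ae hneg] with ω hω
          simpa using hω.ne
        rw [this, Measure.restrict_apply_univ]
        exact pos_iff_ne_zero.2 hne
      · filter_upwards [ae_restrict_of_ae hneg] with ω hω
        simpa using hω.le
      · exact integrable_condExp.restrict.neg
    rw [integral_neg] at hpos
    linarith
  rw [ae_iff]
  exact hμA

theorem condExp_invariants_iterate (g : Ω → ℝ) (i : ℕ) (ω : Ω) :
    (μ[g | MeasurableSpace.invariants τ]) (τ^[i] ω) =
      (μ[g | MeasurableSpace.invariants τ]) ω := by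
  have h := MeasurableSpace.comp_eq_of_measurable_invariants (f := τ)
    (stronglyMeasurable_condExp (m := MeasurableSpace.invariants τ) (μ := μ) (f := g)).measurable
  induction i generalizing ω with
  | zero => rfl
  | succ i ih => rw [Function.iterate_succ_apply, ih]; exact congrFun h ω

/-- Subtracting the conditional expectation plus `ε / 2` makes the conditional mean negative, so the
Birkhoff sums are bounded above by some `C`. The subtracted function is constant along orbits, and
`C / n` is eventually below `ε / 2`. -/
theorem ae_eventually_birkhoffAverage_le [IsProbabilityMeasure μ] (hτ : MeasurePreserving τ μ μ)
    (hf : Measurable f) (hfi : Integrable f μ) {ε : ℝ} (hε : 0 < ε) :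
    ∀ᵐ ω ∂μ, ∀ᶠ n in atTop, birkhoffAverage ℝ τ f n ω ≤
      (μ[f | MeasurableSpace.invariants τ]) ω + ε := by
  have hle := MeasurableSpace.invariants_le τ
  set e := μ[f | MeasurableSpace.invariants τ] with he
  have hem : Measurable[MeasurableSpace.invariants τ] e := stronglyMeasurable_condExp.measurable
  have hei : Integrable e μ := integrable_condExp
  have hgi : Integrable (f - (e + fun _ => ε / 2)) μ := hfi.sub (hei.add (integrable_const _))
  have hneg : ∀ᵐ ω ∂μ,
      (μ[f - (e + fun _ => ε / 2) | MeasurableSpace.invariants τ]) ω < 0 := by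
    have hs : StronglyMeasurable[MeasurableSpace.invariants τ] (e + fun _ => ε / 2) :=
      (hem.add measurable_const).stronglyMeasurable
    filter_upwards [condExp_sub hfi (hei.add (integrable_const (ε / 2)))
      (MeasurableSpace.invariants τ)] with ω hω
    rw [hω, condExp_of_stronglyMeasurable hle hs (hei.add (integrable_const _))]
    simp only [Pi.sub_apply, Pi.add_apply, ← he]
    linarith
  filter_upwards [ae_bddAbove_birkhoffMax hτ
    (hf.sub ((hem.mono hle le_rfl).add measurable_const)) hgi hneg] with ω ⟨C, hC⟩
  have hlim : Tendsto (fun n : ℕ => C / n) atTop (𝓝 0) := tendsto_const_div_atTop_nhds_zero_nat C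
  filter_upwards [hlim.eventually_lt_const (half_pos hε), eventually_ne_atTop 0] with n hn hn0
  obtain ⟨k, rfl⟩ := Nat.exists_eq_succ_of_ne_zero hn0
  have hb := (birkhoffSum_succ_le_birkhoffMax τ (f - (e + fun _ => ε / 2)) k ω).trans
    (hC ⟨k, rfl⟩)
  have hcomp (i : ℕ) : e (τ^[i] ω) = e ω := condExp_invariants_iterate f i ω
  have hpos : (0 : ℝ) < (k + 1 : ℕ) := by positivity
  rw [div_lt_iff₀ hpos] at hn
  simp only [birkhoffSum, Pi.sub_apply, Pi.add_apply, hcomp, Finset.sum_sub_distrib,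
    Finset.sum_const, Finset.card_range, nsmul_eq_mul] at hb
  rw [birkhoffAverage, smul_eq_mul, inv_mul_le_iff₀ hpos, birkhoffSum]
  nlinarith

/-- Birkhoff's pointwise ergodic theorem. -/
theorem ae_tendsto_birkhoffAverage [IsProbabilityMeasure μ] (hτ : MeasurePreserving τ μ μ)
    (hf : Measurable f) (hfi : Integrable f μ) :
    ∀ᵐ ω ∂μ, Tendsto (fun n => birkhoffAverage ℝ τ f n ω) atTop
      (𝓝 ((μ[f | MeasurableSpace.invariants τ]) ω)) := by
  have key (g : Ω → ℝ) (hg : Measurable g) (hgi : Integrable g μ) :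
      ∀ᵐ ω ∂μ, ∀ k : ℕ, ∀ᶠ n in atTop, birkhoffAverage ℝ τ g n ω ≤
        (μ[g | MeasurableSpace.invariants τ]) ω + 1 / ((k : ℝ) + 1) :=
    ae_all_iff.2 fun k => ae_eventually_birkhoffAverage_le hτ hg hgi (by positivity)
  filter_upwards [key f hf hfi, key (-f) hf.neg hfi.neg,
    condExp_neg f (MeasurableSpace.invariants τ)] with ω h1 h2 h3
  rw [Metric.tendsto_atTop']
  intro ε hε
  obtain ⟨k, hk⟩ := exists_nat_one_div_lt hε
  obtain ⟨N, hN⟩ := eventually_atTop.1 ((h1 k).and (h2 k))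
  refine ⟨N, fun n hn => ?_⟩
  obtain ⟨e1, e2⟩ := hN n hn.le
  rw [birkhoffAverage_neg, h3] at e2
  simp only [Pi.neg_apply] at e2
  rw [Real.dist_eq, abs_lt]
  constructor <;> linarith

/-- Almost surely, the orbit avoids every set of conditional probability zero. -/
theorem ae_iterate_notMem_of_condExp_nonpos [IsProbabilityMeasure μ]
    (hτ : MeasurePreserving τ μ μ) {B : Set Ω} (hB : MeasurableSet B) :
    ∀ᵐ ω ∂μ, (μ[B.indicator (fun _ => (1 : ℝ)) | MeasurableSpace.invariants τ]) ω ≤ 0 →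
      ∀ i, τ^[i] ω ∉ B := by
  set p := μ[B.indicator (fun _ => (1 : ℝ)) | MeasurableSpace.invariants τ] with hp
  have hle := MeasurableSpace.invariants_le τ
  have hBi : Integrable (B.indicator (fun _ => (1 : ℝ))) μ := (integrable_const _).indicator hB
  have hC : MeasurableSet[MeasurableSpace.invariants τ] {ω | p ω ≤ 0} :=
    (stronglyMeasurable_condExp.measurable :
      Measurable[MeasurableSpace.invariants τ] p) measurableSet_Iic
  have h1 : ∀ᵐ ω ∂μ, p ω ≤ 0 → ω ∉ B := by
    have h2 := setIntegral_condExp hle hBi hC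
    -- The same integral equals the measure of `B ∩ {p ≤ 0}`, which must therefore be zero.
    have h3 : ∫ ω in {ω | p ω ≤ 0}, p ω ∂μ ≤ 0 := setIntegral_nonpos (hle _ hC) fun ω hω => hω
    rw [← hp] at h2
    rw [h2, integral_indicator_const _ hB, smul_eq_mul, mul_one, measureReal_restrict_apply hB] at h3
    have h4 : μ (B ∩ {ω | p ω ≤ 0}) = 0 :=
      (measureReal_eq_zero_iff (by finiteness)).1 (le_antisymm h3 measureReal_nonneg)
    rw [ae_iff]
    convert h4 using 2
    ext ω
    simp [and_comm]
  have h5 : ∀ᵐ ω ∂μ, ∀ i, p (τ^[i] ω) ≤ 0 → τ^[i] ω ∉ B :=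
    ae_all_iff.2 fun i => (hτ.iterate i).quasiMeasurePreserving.ae h1
  filter_upwards [h5] with ω hω hω0 i
  refine hω i ?_
  rw [hp, condExp_invariants_iterate]
  exact hω0

end Birkhoff

/-! ### Averages of sequences with finitely many values. -/

theorem Finset.sum_equivFin_symm {α M : Type*} [AddCommMonoid M] (F : Finset α) (g : α → M) :
    ∑ i, g (F.equivFin.symm i) = ∑ x ∈ F, g x := by
  rw [Equiv.sum_comp F.equivFin.symm (fun x : F => g x), Finset.sum_coe_sort]

namespace ConvexCombinationSpace

variable {E : Type*} [MetricSpace E] [ConvexCombinationSpace E]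

open Classical in
/-- An average of finitely many values, grouped by value. -/
theorem weighted_average_eq_sum {n : ℕ} (hn : n ≠ 0) (s : ℕ → E) {R : Finset E}
    (hs : ∀ i, s i ∈ R) :
    weighted 1 (average n s) = ∑ x ∈ R,
      weighted (((Finset.range n).filter (fun i => s i = x)).card * (n : ℝ)⁻¹)
        (average ((Finset.range n).filter (fun i => s i = x)).card fun _ => x) := by
  have hn' : (0 : ℝ) < (n : ℝ)⁻¹ := by positivity
  rw [← sum_weighted_average hn, ← Finset.sum_fiberwise_of_maps_to (fun i _ => hs i)]
  refine Finset.sum_congr rfl fun x _ => ?_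
  rw [← nsmul_weighted hn', ← Finset.sum_const]
  exact Finset.sum_congr rfl fun i hi => by rw [(Finset.mem_filter.1 hi).2]

open Classical in
/-- Averages of a sequence with finitely many values converge if the frequencies of the values
converge and values of frequency zero do not occur. -/
theorem tendsto_average_of_frequencies {s : ℕ → E} {R : Finset E} (hs : ∀ i, s i ∈ R) {p : E → ℝ}
    (hp : ∀ x ∈ R, Tendsto (fun n : ℕ =>
      ((Finset.range n).filter (fun i => s i = x)).card * (n : ℝ)⁻¹) atTop (𝓝 (p x)))
    (h0 : ∀ x ∈ R, p x ≤ 0 → ∀ i, s i ≠ x) :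
    Tendsto (fun n => average n s) atTop (𝓝 (combOn R p K)) := by
  set c : ℕ → E → ℕ := fun n x => ((Finset.range n).filter (fun i => s i = x)).card with hc
  set F := R.filter fun x => 0 < p x with hF
  have hsF (i : ℕ) : s i ∈ F := by
    refine Finset.mem_filter.2 ⟨hs i, ?_⟩
    by_contra h
    exact h0 _ (hs i) (not_lt.1 h) i rfl
  have hpF (x : E) (hx : x ∈ F) :
      Tendsto (fun n : ℕ => (c n x : ℝ) * (n : ℝ)⁻¹) atTop (𝓝 (p x)) :=
    hp x (Finset.mem_filter.1 hx).1
  have hpos : ∀ᶠ n : ℕ in atTop, ∀ x ∈ F, 0 < (c n x : ℝ) * (n : ℝ)⁻¹ :=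
    (Finset.eventually_all F).2 fun x hx =>
      (hpF x hx).eventually_const_lt (Finset.mem_filter.1 hx).2
  have hsum (n : ℕ) (hn : n ≠ 0) : ∑ x ∈ F, (c n x : ℝ) * (n : ℝ)⁻¹ = 1 := by
    have := Finset.card_eq_sum_card_fiberwise (s := Finset.range n) (fun i _ => hsF i)
    rw [Finset.card_range] at this
    rw [← Finset.sum_mul, ← Nat.cast_sum, ← this]
    exact mul_inv_cancel₀ (by positivity)
  have hc_top (x : E) (hx : x ∈ F) : Tendsto (fun n => c n x) atTop atTop := by
    have h1 := (hpF x hx).pos_mul_atTop (Finset.mem_filter.1 hx).2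
      (tendsto_natCast_atTop_atTop (R := ℝ))
    rw [← tendsto_natCast_atTop_iff (R := ℝ)]
    refine h1.congr' ?_
    filter_upwards [eventually_ne_atTop 0] with n hn
    field_simp
  -- `tendsto_comb` asks for admissible weights at every index, so the sequence is shifted past the
  -- last zero frequency.
  obtain ⟨N, hN⟩ := eventually_atTop.1 (hpos.and (eventually_ne_atTop 0))
  rw [← tendsto_add_atTop_iff_nat N]
  have hw (n : ℕ) : IsWeight fun i => (c (n + N) (F.equivFin.symm i) : ℝ) * ((n + N : ℕ) : ℝ)⁻¹ :=
    ⟨fun i => (hN (n + N) (by omega)).1 _ (F.equivFin.symm i).2,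
      (F.sum_equivFin_symm fun x => (c (n + N) x : ℝ) * ((n + N : ℕ) : ℝ)⁻¹).trans
        (hsum _ (hN (n + N) (by omega)).2)⟩
  have hw₀ : IsWeight fun i => p (F.equivFin.symm i) := by
    refine ⟨fun i => (Finset.mem_filter.1 (F.equivFin.symm i).2).2, (F.sum_equivFin_symm p).trans ?_⟩
    refine tendsto_nhds_unique (tendsto_finsetSum _ hpF) (tendsto_const_nhds.congr' ?_)
    filter_upwards [eventually_ne_atTop 0] with n hn
    exact (hsum n hn).symm
  have heq (n : ℕ) : average (n + N) s =
      comb (fun i => (c (n + N) (F.equivFin.symm i) : ℝ) * ((n + N : ℕ) : ℝ)⁻¹)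
        (fun i => average (c (n + N) (F.equivFin.symm i)) fun _ => (F.equivFin.symm i : E)) := by
    refine weighted_one_injective ?_
    rw [← sum_weighted_eq _ _ (hw n), weighted_average_eq_sum (hN (n + N) (by omega)).2 s hsF]
    exact (F.sum_equivFin_symm fun x => weighted ((c (n + N) x : ℝ) * ((n + N : ℕ) : ℝ)⁻¹)
      (average (c (n + N) x) fun _ => x)).symm
  simp only [heq]
  refine (tendsto_comb hw hw₀ (fun i => ?_) (fun i => ?_)).congr' EventuallyEq.rfl
  · exact (tendsto_add_atTop_iff_nat N).2 (hpF _ (F.equivFin.symm i).2)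
  · exact (tendsto_average_const _).comp
      ((tendsto_add_atTop_iff_nat N).2 (hc_top _ (F.equivFin.symm i).2))

variable {Ω : Type*} [MeasurableSpace Ω] {μ : Measure Ω} [IsProbabilityMeasure μ] {τ : Ω → Ω}

/-- The ergodic theorem for simple random elements. -/
theorem ae_tendsto_average_simpleFunc [MeasurableSpace E] (hτ : MeasurePreserving τ μ μ)
    (S : SimpleFunc Ω E) :
    ∀ᵐ ω ∂μ, Tendsto (fun n => average n fun i => S (τ^[i] ω)) atTop
      (𝓝 (condExpSimple (MeasurableSpace.invariants τ) μ S ω)) := by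
  classical
  have h1 : ∀ᵐ ω ∂μ, ∀ x ∈ S.range,
      Tendsto (fun n => birkhoffAverage ℝ τ ((S ⁻¹' {x}).indicator fun _ => (1 : ℝ)) n ω) atTop
        (𝓝 ((μ[(S ⁻¹' {x}).indicator (fun _ => (1 : ℝ)) | MeasurableSpace.invariants τ]) ω)) :=
    (Finset.eventually_all _).2 fun x _ => ae_tendsto_birkhoffAverage hτ
      (measurable_const.indicator (S.measurableSet_fiber x))
      ((integrable_const _).indicator (S.measurableSet_fiber x))
  have h2 : ∀ᵐ ω ∂μ, ∀ x ∈ S.range,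
      (μ[(S ⁻¹' {x}).indicator (fun _ => (1 : ℝ)) | MeasurableSpace.invariants τ]) ω ≤ 0 →
        ∀ i, τ^[i] ω ∉ S ⁻¹' {x} :=
    (Finset.eventually_all _).2 fun x _ =>
      ae_iterate_notMem_of_condExp_nonpos hτ (S.measurableSet_fiber x)
  filter_upwards [h1, h2] with ω hω1 hω2
  refine tendsto_average_of_frequencies (fun i => S.mem_range_self _) (fun x hx => ?_)
    (fun x hx hx0 i => ?_)
  · refine (hω1 x hx).congr fun n => ?_
    rw [birkhoffAverage, birkhoffSum, smul_eq_mul, mul_comm, Finset.card_filter]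
    push_cast
    congr 1
  · simpa using hω2 x hx hx0 i

end ConvexCombinationSpace

/-! ### Passage from simple to integrable random elements. -/

/-- A sequence that stays asymptotically within `D k` of `z k`, with `D k → 0`, converges to the
limit of `z`. -/
theorem exists_tendsto_of_dist_le {E : Type*} [MetricSpace E] [CompleteSpace E] {y z : ℕ → E}
    {b : ℕ → ℕ → ℝ} {D : ℕ → ℝ} (hD : Tendsto D atTop (𝓝 0))
    (hb : ∀ k, Tendsto (b k) atTop (𝓝 (D k))) {y' : ℕ → ℕ → E}
    (hy : ∀ k, ∀ᶠ n in atTop, dist (y n) (y' k n) ≤ b k n)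
    (hz : ∀ k, Tendsto (y' k) atTop (𝓝 (z k))) :
    ∃ l, Tendsto y atTop (𝓝 l) ∧ Tendsto z atTop (𝓝 l) := by
  have hev (k : ℕ) {ε : ℝ} (hε : 0 < ε) : ∀ᶠ n in atTop, dist (y n) (z k) < D k + ε := by
    filter_upwards [hy k, (hb k).eventually_lt_const (lt_add_of_pos_right _ (half_pos hε)),
      (hz k).eventually (Metric.ball_mem_nhds _ (half_pos hε))] with n h1 h2 h3
    have := dist_triangle (y n) (y' k n) (z k)
    linarith
  have hcauchy : CauchySeq y := by
    refine Metric.cauchySeq_iff.2 fun ε hε => ?_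
    -- Two terms, each within `D k + ε / 4 < ε / 2` of `z k`, are within `ε` of each other.
    obtain ⟨k, hk⟩ := (hD.eventually_lt_const (by positivity : 0 < ε / 4)).exists
    obtain ⟨N, hN⟩ := eventually_atTop.1 (hev k (by positivity : 0 < ε / 4))
    refine ⟨N, fun m hm n hn => ?_⟩
    have := dist_triangle_right (y m) (y n) (z k)
    linarith [hN m hm, hN n hn]
  obtain ⟨l, hl⟩ := cauchySeq_tendsto_of_complete hcauchy
  refine ⟨l, hl, tendsto_iff_dist_tendsto_zero.2 (squeeze_zero (fun _ => dist_nonneg)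
    (fun k => ?_) hD)⟩
  rw [dist_comm]
  refine le_of_forall_pos_le_add fun ε hε => ?_
  refine le_of_tendsto (hl.dist tendsto_const_nhds) ?_
  filter_upwards [hev k hε] with n hn using hn.le

theorem theorem4p14 {E : Type*} [MetricSpace E] [ConvexCombinationSpace E]
    [CompleteSpace E] [TopologicalSpace.SeparableSpace E] [MeasurableSpace E] [BorelSpace E]
    {Ω : Type*} [MeasurableSpace Ω] (μ : Measure Ω) [IsProbabilityMeasure μ]
    (u : ℕ → E) (hu₀ : u 0 ∈ Set.range (ConvexCombinationSpace.K : E → E))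
    (hu : DenseRange fun j : ℕ => u (j + 1))
    (τ : Ω → Ω) (hτ : MeasurePreserving τ μ μ)
    (X : Ω → E) (hX : Measurable X) (hXi : ∃ a : E, Integrable (fun ω => dist a (X ω)) μ) :
    (∀ᵐ ω ∂μ, Tendsto
      (fun n : ℕ => ConvexCombinationSpace.condExpApprox u (MeasurableSpace.invariants τ)
        μ X hX n ω) atTop
      (𝓝 (ConvexCombinationSpace.condExp u (MeasurableSpace.invariants τ) μ X hX ω))) ∧
    ∀ᵐ ω ∂μ, Tendsto
      (fun n : ℕ => ConvexCombinationSpace.average n (fun i => X (τ^[i] ω))) atTop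
      (𝓝 (ConvexCombinationSpace.condExp u (MeasurableSpace.invariants τ) μ X hX ω)) := by
  have : SecondCountableTopology E := UniformSpace.secondCountable_of_separable E
  obtain ⟨a, ha⟩ := hXi
  set S : ℕ → SimpleFunc Ω E := fun k => (SimpleFunc.nearestPt u k).comp X hX with hS
  set f : ℕ → Ω → ℝ := fun k ω => dist (X ω) (S k ω) with hf
  have hfm (k : ℕ) : Measurable (f k) := hX.dist (S k).measurable
  have hle (k j : ℕ) (hj : j ≤ k) (ω : Ω) : f k ω ≤ dist (X ω) (u j) := by
    have := SimpleFunc.edist_nearestPt_le u (X ω) hj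
    rw [edist_dist, edist_dist, ENNReal.ofReal_le_ofReal_iff dist_nonneg] at this
    simpa only [hf, hS, dist_comm (X ω), SimpleFunc.coe_comp, Function.comp_apply] using this
  have hbound : Integrable (fun ω => dist (X ω) (u 0)) μ := by
    refine (ha.add (integrable_const (dist a (u 0)))).mono'
      (hX.dist measurable_const).aestronglyMeasurable (ae_of_all _ fun ω => ?_)
    rw [Real.norm_of_nonneg dist_nonneg]
    exact dist_triangle_left _ _ _
  have hfi (k : ℕ) : Integrable (f k) μ :=
    hbound.mono' (hfm k).aestronglyMeasurable (ae_of_all _ fun ω => by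
      rw [Real.norm_of_nonneg dist_nonneg]; exact hle k 0 k.zero_le ω)
  have hanti : ∀ ω, Antitone fun k => f k ω := fun ω => antitone_nat_of_succ_le fun k => by
    have : S k ω = u (SimpleFunc.nearestPtInd u k (X ω)) := rfl
    rw [hf]
    simp only [this]
    -- The nearest point at stage `k` is still a candidate at stage `k + 1`.
    exact hle (k + 1) _ ((SimpleFunc.nearestPtInd_le u k (X ω)).trans k.le_succ) ω
  have hf0 (ω : Ω) : Tendsto (fun k => f k ω) atTop (𝓝 0) := by
    have hcl : X ω ∈ closure (Set.range u) :=
      closure_mono (Set.range_comp_subset_range (fun j => j + 1) u) (hu (X ω))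
    have := (tendsto_const_nhds (x := X ω)).dist (SimpleFunc.tendsto_nearestPt hcl)
    rwa [dist_self] at this
  have hint : Tendsto (fun k => ∫ ω, f k ω ∂μ) atTop (𝓝 0) := by
    have := tendsto_integral_of_dominated_convergence (fun ω => dist (X ω) (u 0))
      (fun k => (hfm k).aestronglyMeasurable) hbound
      (fun k => ae_of_all _ fun ω => by
        rw [Real.norm_of_nonneg dist_nonneg]; exact hle k 0 k.zero_le ω)
      (ae_of_all μ hf0)
    simpa using this
  have hD : ∀ᵐ ω ∂μ, Tendsto
      (fun k => (μ[f k | MeasurableSpace.invariants τ]) ω) atTop (𝓝 0) := by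
    -- Convergence of the integrals to 0 upgrades to a.e. convergence because the conditional
    -- expectations are nonnegative and decrease in `k`.
    refine tendsto_of_integral_tendsto_of_antitone (F := fun _ => 0)
      (fun k => integrable_condExp) (integrable_zero _ _ _) ?_ ?_ ?_
    · simpa only [integral_condExp (MeasurableSpace.invariants_le τ), integral_zero] using hint
    · have := ae_all_iff.2 fun k => condExp_mono (m := MeasurableSpace.invariants τ)
        (hfi (k + 1)) (hfi k) (ae_of_all μ fun ω => hanti ω k.le_succ)
      filter_upwards [this] with ω hω using antitone_nat_of_succ_le hω
    · exact ae_all_iff.2 fun k => condExp_nonneg (ae_of_all _ fun ω => dist_nonneg)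
  have key : ∀ᵐ ω ∂μ, ∃ l,
      Tendsto (fun n => ConvexCombinationSpace.average n fun i => X (τ^[i] ω)) atTop (𝓝 l) ∧
      Tendsto (fun n => ConvexCombinationSpace.condExpApprox u (MeasurableSpace.invariants τ)
        μ X hX n ω) atTop (𝓝 l) := by
    filter_upwards [hD, ae_all_iff.2 fun k => ae_tendsto_birkhoffAverage hτ (hfm k) (hfi k),
      ae_all_iff.2 fun k => ConvexCombinationSpace.ae_tendsto_average_simpleFunc hτ (S k)]
      with ω h1 h2 h3
    refine exists_tendsto_of_dist_le h1 h2 (fun k => ?_) h3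
    filter_upwards [eventually_ne_atTop 0] with n hn
    exact ConvexCombinationSpace.dist_average_le hn _ _
  have hlim (ω : Ω) (l : E) (hl : Tendsto (fun n => ConvexCombinationSpace.condExpApprox u
      (MeasurableSpace.invariants τ) μ X hX n ω) atTop (𝓝 l)) :
      ConvexCombinationSpace.condExp u (MeasurableSpace.invariants τ) μ X hX ω = l :=
    hl.limUnder_eq
  constructor
  · filter_upwards [key] with ω ⟨l, _, h2⟩
    rwa [hlim ω l h2]
  · filter_upwards [key] with ω ⟨l, h1, h2⟩
    rwa [hlim ω l h2]
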